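/- Give $2^\omega=\{0,1\}^{\mathbb N}$ the product topology. A set $X\subseteq 2^\omega$ is a *$\lambda$-set* if every countable subset of $X$ is a $G_\delta$ subset of the subspace $X$. For $x,y\in 2^\omega$ write $x\sim y$ if there are $m,n\in\omega$ with $x(m+k)=y(n+k)$ for all $k\in\omega$; $X$ is *saturated* if $X=X^*$, where $X^*=\{y\in 2^\omega:\exists x\in X\ (y\sim x)\}$. A separable topological space $Z$ is *countable dense homogeneous* (CDH) if for any two countable dense subsets $D,E$ of $Z$ there is a homeomorphism $f\colon Z\to Z$ with $f[D]=E$. **Theorem.** Let $X\subseteq 2^\omega$ be an uncountable saturated $\lambda$-set. Then the finite power $X^n$ (with the product topology) is CDH for every $n\in\omega$, while the countably infinite power $X^\omega$ (with the product topology) is not CDH. -/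

import Mathlib

namespace LambdaSets

/-- A separable topological space `X` is countable dense homogeneous (CDH) if for any two countable
dense subsets `D`, `E` of `X` some autohomeomorphism of `X` maps `D` onto `E`. -/
def IsCDH (X : Type*) [TopologicalSpace X] : Prop :=
  TopologicalSpace.SeparableSpace X ∧
    ∀ D E : Set X, D.Countable → Dense D → E.Countable → Dense E →
      ∃ f : X ≃ₜ X, f '' D = E

/-- The Cantor set `2^ω`, with the product topology. -/
abbrev Cantor : Type := ℕ → Bool

/-- A subset `X` of `2^ω` is a λ-set if every countable subset of `X` is a relative `G_δ` in `X`. -/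
def IsLambdaSet (X : Set Cantor) : Prop :=
  ∀ A : Set Cantor, A ⊆ X → A.Countable → IsGδ ((↑) ⁻¹' A : Set X)

/-- Tail equivalence on `2^ω`. -/
def TailEquiv (x y : Cantor) : Prop :=
  ∃ m n : ℕ, ∀ k : ℕ, x (m + k) = y (n + k)

/-- The saturation `X^*` of `X` with respect to tail equivalence. -/
def saturation (X : Set Cantor) : Set Cantor :=
  {y | ∃ x ∈ X, TailEquiv y x}

/-- `X` is saturated if `X = X^*`. -/
def IsSaturated (X : Set Cantor) : Prop :=
  X = saturation X

end LambdaSets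

/-! Saturation is used only as closure under finite modifications. Given countable dense `D`, `E`,
enlarge their union to a countable `A ⊆ X` that is closed under finite modifications and has `A \ D`
and `A \ E` dense. The λ-property covers `X \ A` by increasing closed sets `K n` of the Cantor set,
disjoint from `A`. A back-and-forth over `A` with tree automorphisms, each correction supported in a
small cylinder that avoids the relevant closed sets, freezes stage `n` and its inverse on `K n`. The
limit thus preserves `X` and carries `D` onto `E` (`exists_extend`, `exists_perm_of_biDense`).
Finite powers reduce to this case by interleaving coordinates (`isCDH_pi_fin`).

In contrast, `X` is meager in itself, which gives the infinite power a countable dense `G_δ` set.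
That power also contains a Cantor set; adding a countable dense subset of it destroys the `G_δ`
property, by Baire (`not_isCDH_pi_nat`). -/

namespace LambdaSets

open Set Topology PiNat

/-! ### Finite modifications of points of the Cantor set -/

/-- Two points of the Cantor set that differ in only finitely many coordinates. -/
def FinEq (x y : Cantor) : Prop := {i | x i ≠ y i}.Finite

theorem FinEq.refl (x : Cantor) : FinEq x x := by simp [FinEq]

theorem FinEq.symm {x y : Cantor} (h : FinEq x y) : FinEq y x := by
  simpa only [FinEq, ne_comm] using h

theorem FinEq.trans {x y z : Cantor} (h : FinEq x y) (h' : FinEq y z) : FinEq x z := by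
  refine (Set.Finite.union h h').subset fun i hi => ?_
  by_contra hc
  simp only [mem_union, mem_ofPred_eq, not_or, not_not] at hc hi
  exact hi (hc.1.trans hc.2)

theorem FinEq.of_eventually {x y : Cantor} (n : ℕ) (h : ∀ i, n ≤ i → x i = y i) : FinEq x y :=
  (finite_lt_nat n).subset fun i hi => by
    by_contra hc
    exact hi (h i (not_lt.1 hc))

theorem FinEq.tailEquiv {x y : Cantor} (h : FinEq x y) : TailEquiv x y := by
  obtain ⟨n, hn⟩ := h.bddAbove
  refine ⟨n + 1, n + 1, fun k => ?_⟩
  by_contra hc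
  have : n + 1 + k ≤ n := hn hc
  omega

theorem countable_finEq (x : Cantor) : {y | FinEq y x}.Countable := by
  classical
  refine (countable_range fun (S : Finset ℕ) (i : ℕ) => if i ∈ S then !x i else x i).mono ?_
  intro y (hy : {i | y i ≠ x i}.Finite)
  refine ⟨hy.toFinset, funext fun i => ?_⟩
  by_cases h : y i = x i
  · simp [h]
  · have : y i = !x i := by
      cases hx : x i <;> cases hy : y i <;> simp_all
    simp [this]

theorem exists_finEq_mem_cylinder (x c : Cantor) (n : ℕ) : ∃ y ∈ cylinder c n, FinEq y x :=
  ⟨fun i => if i < n then c i else x i, fun i hi => by simp [hi],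
    .of_eventually n fun i hi => by simp [not_lt.2 hi]⟩

/-- A set of points that is closed under finite modifications. -/
def FinClosed (X : Set Cantor) : Prop := ∀ ⦃x y⦄, FinEq x y → x ∈ X → y ∈ X

theorem IsSaturated.finClosed {X : Set Cantor} (h : IsSaturated X) : FinClosed X := by
  intro x y hxy hx
  rw [h]
  exact ⟨x, hx, hxy.symm.tailEquiv⟩

theorem isOpen_iff_cylinder {U : Set Cantor} :
    IsOpen U ↔ ∀ x ∈ U, ∃ n, cylinder x n ⊆ U := by
  constructor
  · intro hU x hx
    obtain ⟨n, hn⟩ := exists_disjoint_cylinder hU.isClosed_compl (x := x) (by simpa using hx)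
    exact ⟨n, by simpa [disjoint_compl_left_iff_subset] using hn⟩
  · intro h
    rw [isOpen_iff_mem_nhds]
    intro x hx
    obtain ⟨n, hn⟩ := h x hx
    exact Filter.mem_of_superset ((isOpen_cylinder _ x n).mem_nhds (self_mem_cylinder x n)) hn

/-! ### Level preserving permutations -/

/-- A permutation of the Cantor set that is induced by an automorphism of the binary tree. -/
def LevelPreserving (f : Equiv.Perm Cantor) : Prop :=
  ∀ x y n, f y ∈ cylinder (f x) n ↔ y ∈ cylinder x n

theorem LevelPreserving.symm {f : Equiv.Perm Cantor} (hf : LevelPreserving f) :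
    LevelPreserving f.symm := fun x y n => by
  simpa using (hf (f.symm x) (f.symm y) n).symm

theorem LevelPreserving.trans {f g : Equiv.Perm Cantor} (hf : LevelPreserving f)
    (hg : LevelPreserving g) : LevelPreserving (f.trans g) := fun x y n =>
  (hg _ _ n).trans (hf x y n)

theorem LevelPreserving.continuous {f : Equiv.Perm Cantor} (hf : LevelPreserving f) :
    Continuous f := by
  refine continuous_pi fun i => IsLocallyConstant.continuous ?_
  rw [IsLocallyConstant.iff_exists_open]
  exact fun x => ⟨cylinder x (i + 1), isOpen_cylinder _ x _, self_mem_cylinder x _,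
    fun y hy => (hf x y (i + 1)).2 hy i i.lt_succ_self⟩

theorem LevelPreserving.isClosed_image {f : Equiv.Perm Cantor} (hf : LevelPreserving f)
    {C : Set Cantor} (hC : IsClosed C) : IsClosed (f '' C) := by
  rw [f.image_eq_preimage_symm]
  exact hC.preimage hf.symm.continuous

open Classical in
/-- The map that carries `a` to `b`, and flips finitely many coordinates of any other point. -/
noncomputable def moveFun (a b x : Cantor) : Cantor := fun i =>
  if x ∈ cylinder a i then xor (x i) (xor (a i) (b i)) else x i

/-- Whether coordinate `i` is flipped depends only on the coordinates before `i`. -/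
theorem moveFun_mem_cylinder_iff (a b x y : Cantor) (n : ℕ) :
    moveFun a b y ∈ cylinder (moveFun a b x) n ↔ y ∈ cylinder x n := by
  induction n with
  | zero => simp
  | succ n ih =>
    have key : ∀ u v : Cantor, u ∈ cylinder v (n + 1) ↔ u ∈ cylinder v n ∧ u n = v n := by
      intro u v
      exact Nat.forall_lt_succ_right
    rw [key, key, ih]
    refine and_congr_right fun h => ?_
    have h' : y ∈ cylinder a n ↔ x ∈ cylinder a n := by
      rw [mem_cylinder_iff_eq, mem_cylinder_iff_eq, mem_cylinder_iff_eq.1 h]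
    by_cases hx : x ∈ cylinder a n
    · simp [moveFun, hx, h'.2 hx]
    · simp [moveFun, hx, mt h'.1 hx]

theorem moveFun_self (a b : Cantor) : moveFun a b a = b := by
  ext i
  simp [moveFun]

theorem moveFun_moveFun (a b x : Cantor) : moveFun b a (moveFun a b x) = x := by
  ext i
  have h : moveFun a b x ∈ cylinder b i ↔ x ∈ cylinder a i := by
    simpa [moveFun_self] using moveFun_mem_cylinder_iff a b a x i
  by_cases hx : x ∈ cylinder a i
  · rw [moveFun, if_pos (h.2 hx), moveFun, if_pos hx]
    cases x i <;> cases a i <;> cases b i <;> rfl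
  · rw [moveFun, if_neg (mt h.1 hx), moveFun, if_neg hx]

/-- `moveFun` as a permutation. -/
noncomputable def move (a b : Cantor) : Equiv.Perm Cantor where
  toFun := moveFun a b
  invFun := moveFun b a
  left_inv := moveFun_moveFun a b
  right_inv := moveFun_moveFun b a

theorem move_levelPreserving (a b : Cantor) : LevelPreserving (move a b) :=
  moveFun_mem_cylinder_iff a b

theorem moveFun_finEq {a x : Cantor} (b : Cantor) (h : x ≠ a) : FinEq (moveFun a b x) x := by
  refine .of_eventually (firstDiff x a + 1) fun i hi => ?_
  have : x ∉ cylinder a i := by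
    rw [mem_cylinder_iff_le_firstDiff h]
    omega
  simp [moveFun, this]

theorem moveFun_of_notMem {a b x : Cantor} {k : ℕ} (hb : b ∈ cylinder a k)
    (hx : x ∉ cylinder a k) : moveFun a b x = x := by
  ext i
  by_cases h : x ∈ cylinder a i
  · have hik : i < k := by
      by_contra hc
      exact hx (cylinder_anti a (not_lt.1 hc) h)
    simp [moveFun, hb i hik]
  · simp [moveFun, h]

theorem moveFun_mem_of_finClosed {X : Set Cantor} (hX : FinClosed X) {a b x : Cantor}
    (hb : b ∈ X) (hx : x ∈ X) : moveFun a b x ∈ X := by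
  by_cases h : x = a
  · rwa [h, moveFun_self]
  · exact hX (moveFun_finEq b h).symm hx

theorem move_mem_iff {X : Set Cantor} (hX : FinClosed X) {a b : Cantor}
    (ha : a ∈ X) (hb : b ∈ X) (x : Cantor) : move a b x ∈ X ↔ x ∈ X :=
  ⟨fun h => by
    have := moveFun_mem_of_finClosed hX (a := b) ha h
    rwa [show move a b x = moveFun a b x from rfl, moveFun_moveFun] at this,
    moveFun_mem_of_finClosed hX hb⟩

/-! ### One step of the back-and-forth construction -/

/-- Level preserving permutations that leave `X` and `A` invariant. -/
structure Preserves (X A : Set Cantor) (f : Equiv.Perm Cantor) : Prop where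
  level : LevelPreserving f
  mem_left : ∀ x, f x ∈ X ↔ x ∈ X
  mem_right : ∀ x, f x ∈ A ↔ x ∈ A

theorem Preserves.symm {X A : Set Cantor} {f : Equiv.Perm Cantor} (h : Preserves X A f) :
    Preserves X A f.symm :=
  ⟨h.level.symm, fun x => by simpa using (h.mem_left (f.symm x)).symm,
    fun x => by simpa using (h.mem_right (f.symm x)).symm⟩

/-- `D` and `A \ D` meet every basic clopen set. -/
def BiDense (A D : Set Cantor) : Prop :=
  ∀ c n, (∃ y ∈ cylinder c n, y ∈ A ∧ y ∈ D) ∧ ∃ y ∈ cylinder c n, y ∈ A ∧ y ∉ D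

/-- Follow `f` by a `move` from `f a` to a nearby `b`. Its cylinder avoids `f '' K` and `f '' P`,
which keeps the old values, and avoids `K`, which keeps the inverse on `K`. -/
theorem exists_extend_forward {X A D E K : Set Cantor} (hX : FinClosed X) (hA : FinClosed A)
    (hAX : A ⊆ X) (hE : BiDense A E) (hK : IsClosed K) (hKA : Disjoint K A) (n : ℕ)
    {f : Equiv.Perm Cantor} (hf : Preserves X A f) {P : Set Cantor} (hP : P.Finite)
    (hPD : ∀ p ∈ P, p ∈ D ↔ f p ∈ E) {a : Cantor} (ha : a ∈ A) :
    ∃ g : Equiv.Perm Cantor, Preserves X A g ∧ (∀ p ∈ insert a P, p ∈ D ↔ g p ∈ E) ∧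
      (∀ x ∈ P, g x = f x) ∧ (∀ x ∈ K, g x = f x) ∧ (∀ x ∈ K, g.symm x = f.symm x) ∧
      ∀ x, g x ∈ cylinder (f x) n := by
  by_cases haP : a ∈ P
  · exact ⟨f, hf, by rwa [insert_eq_of_mem haP], fun _ _ => rfl, fun _ _ => rfl, fun _ _ => rfl,
      fun x => self_mem_cylinder _ n⟩
  have hcl : IsClosed (K ∪ f '' K ∪ f '' P) :=
    (hK.union (hf.level.isClosed_image hK)).union (hP.image f).isClosed
  have hfa : f a ∈ A := (hf.mem_right a).2 ha
  have hmem : f a ∉ K ∪ f '' K ∪ f '' P := by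
    simp only [mem_union, mem_image, EmbeddingLike.apply_eq_iff_eq, exists_eq_right, not_or]
    exact ⟨⟨fun h => hKA.notMem_of_mem_left h hfa, fun h => hKA.notMem_of_mem_left h ha⟩, haP⟩
  obtain ⟨m, hm⟩ := exists_disjoint_cylinder hcl hmem
  set k := max m n
  have hk : Disjoint (K ∪ f '' K ∪ f '' P) (cylinder (f a) k) :=
    hm.mono_right (cylinder_anti _ (le_max_left m n))
  obtain ⟨b, hbk, hbA, hb⟩ : ∃ b ∈ cylinder (f a) k, b ∈ A ∧ (a ∈ D ↔ b ∈ E) := by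
    by_cases haD : a ∈ D
    · obtain ⟨y, h1, h2, h3⟩ := (hE (f a) k).1
      exact ⟨y, h1, h2, by simp [haD, h3]⟩
    · obtain ⟨y, h1, h2, h3⟩ := (hE (f a) k).2
      exact ⟨y, h1, h2, by simp [haD, h3]⟩
  have hfix : ∀ x ∈ K ∪ f '' K ∪ f '' P, move (f a) b x = x := fun x hx =>
    moveFun_of_notMem hbk (hk.notMem_of_mem_left hx)
  have hfP : ∀ x ∈ P, move (f a) b (f x) = f x := fun x hx =>
    hfix _ (Or.inr (mem_image_of_mem f hx))
  refine ⟨f.trans (move (f a) b), ⟨hf.level.trans (move_levelPreserving _ _),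
    fun x => (move_mem_iff hX (hAX hfa) (hAX hbA) _).trans (hf.mem_left x),
    fun x => (move_mem_iff hA hfa hbA _).trans (hf.mem_right x)⟩, ?_, hfP,
    fun x hx => hfix _ (Or.inl (Or.inr (mem_image_of_mem f hx))), ?_, ?_⟩
  · rintro p (rfl | hp)
    · have : move (f p) b (f p) = b := moveFun_self _ _
      simpa [this] using hb
    · simpa [hfP p hp] using hPD p hp
  · intro x hx
    have := hfix x (Or.inl (Or.inl hx))
    simp only [Equiv.symm_trans_apply, EmbeddingLike.apply_eq_iff_eq]
    rw [Equiv.symm_apply_eq, this]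
  · intro x
    by_cases hx : f x ∈ cylinder (f a) k
    · refine cylinder_anti _ (le_max_right m n) ?_
      have h1 : move (f a) b (f x) ∈ cylinder (move (f a) b (f a)) k :=
        (move_levelPreserving _ _ _ _ _).2 hx
      have h2 : move (f a) b (f a) = b := moveFun_self _ _
      rw [h2] at h1
      rw [mem_cylinder_iff_eq] at *
      exact h1.trans (hbk.trans hx.symm)
    · have : move (f a) b (f x) = f x := moveFun_of_notMem hbk hx
      simp [this]

theorem LevelPreserving.symm_mem_cylinder {f g : Equiv.Perm Cantor} (hf : LevelPreserving f)
    {n : ℕ} (h : ∀ x, g x ∈ cylinder (f x) n) (y : Cantor) :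
    g.symm y ∈ cylinder (f.symm y) n := by
  rw [← hf, mem_cylinder_comm]
  simpa using h (g.symm y)

/-- A forward step for `f`, then a forward step for the inverse with `D` and `E` exchanged. -/
theorem exists_extend {X A D E K : Set Cantor} (hX : FinClosed X) (hA : FinClosed A)
    (hAX : A ⊆ X) (hD : BiDense A D) (hE : BiDense A E) (hK : IsClosed K) (hKA : Disjoint K A)
    (n : ℕ) {f : Equiv.Perm Cantor} (hf : Preserves X A f) {P : Set Cantor} (hP : P.Finite)
    (hPA : P ⊆ A) (hPD : ∀ p ∈ P, p ∈ D ↔ f p ∈ E) {a : Cantor} (ha : a ∈ A) :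
    ∃ (g : Equiv.Perm Cantor) (Q : Set Cantor), Preserves X A g ∧ Q.Finite ∧ Q ⊆ A ∧
      (∀ p ∈ Q, p ∈ D ↔ g p ∈ E) ∧ P ⊆ Q ∧ a ∈ Q ∧ g.symm a ∈ Q ∧
      (∀ x ∈ P, g x = f x) ∧ (∀ x ∈ K, g x = f x) ∧ (∀ x ∈ K, g.symm x = f.symm x) ∧
      ∀ x, g x ∈ cylinder (f x) n := by
  obtain ⟨g, hg, hgD, hgP, hgK, hgK', hgn⟩ :=
    exists_extend_forward hX hA hAX hE hK hKA n hf hP hPD ha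
  have hQ : (insert a P).Finite := hP.insert a
  have hQA : insert a P ⊆ A := insert_subset ha hPA
  obtain ⟨h, hh, hhD, hhP, hhK, hhK', hhn⟩ :=
    exists_extend_forward (D := E) (P := g '' insert a P) hX hA hAX hD hK hKA n hg.symm
      (hQ.image g)
      (by rintro _ ⟨p, hp, rfl⟩; simpa using (hgD p hp).symm) ha
  have hhg : ∀ p ∈ insert a P, h.symm p = g p := fun p hp => by
    rw [Equiv.symm_apply_eq, hhP _ (mem_image_of_mem g hp), Equiv.symm_apply_apply]
  refine ⟨h.symm, insert (h a) (insert a P), hh.symm, hQ.insert _,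
    insert_subset ((hh.mem_right a).2 ha) hQA, ?_, ?_, ?_, ?_, ?_, ?_, ?_, ?_⟩
  · rintro p (rfl | hp)
    · simpa using (hhD a (mem_insert _ _)).symm
    · rw [hhg p hp]
      exact hgD p hp
  · exact (subset_insert _ _).trans (subset_insert _ _)
  · exact Or.inr (mem_insert _ _)
  · simp
  · exact fun x hx => (hhg x (Or.inr hx)).trans (hgP x hx)
  · intro x hx
    rw [hhK' x hx]
    simpa using hgK x hx
  · intro x hx
    rw [Equiv.symm_symm, hhK x hx, hgK' x hx]
  · intro x
    have h1 := hg.level.symm.symm_mem_cylinder hhn x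
    have h2 := hgn x
    rw [Equiv.symm_symm, mem_cylinder_iff_eq] at h1
    rw [mem_cylinder_iff_eq] at *
    exact h1.trans h2

/-! ### The limit of the construction -/

theorem exists_limit {f : ℕ → Equiv.Perm Cantor} (hf : ∀ n, LevelPreserving (f n))
    (h : ∀ n x, f (n + 1) x ∈ cylinder (f n x) n) :
    ∃ F : Equiv.Perm Cantor, LevelPreserving F ∧
      (∀ n x, F x ∈ cylinder (f n x) n) ∧ ∀ n x, F.symm x ∈ cylinder ((f n).symm x) n := by
  -- Coordinate `i` no longer changes from stage `i + 1` on.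
  have lim : ∀ g : ℕ → Cantor → Cantor, (∀ n x, g (n + 1) x ∈ cylinder (g n x) n) →
      ∀ n x, (fun i => g (i + 1) x i) ∈ cylinder (g n x) n := by
    intro g hg n x i hi
    induction n, (Nat.succ_le_of_lt hi) using Nat.le_induction with
    | base => rfl
    | succ n hn ih => exact (ih hn).trans (hg n x i hn).symm
  have h' : ∀ n x, (f (n + 1)).symm x ∈ cylinder ((f n).symm x) n := fun n =>
    (hf n).symm_mem_cylinder (h n)
  have hF := lim (fun n => f n) h
  have hG := lim (fun n => (f n).symm) h'
  have ext_cyl : ∀ x y : Cantor, (∀ n, x ∈ cylinder y n) → x = y := fun x y hxy =>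
    funext fun i => hxy (i + 1) i i.lt_succ_self
  refine ⟨⟨fun x i => f (i + 1) x i, fun x i => (f (i + 1)).symm x i, fun x => ?_, fun x => ?_⟩,
    fun x y n => ?_, hF, hG⟩
  · refine ext_cyl _ _ fun n => ?_
    have h1 := hG n fun i => f (i + 1) x i
    have h2 := ((hf n).symm _ _ n).2 (hF n x)
    rw [mem_cylinder_iff_eq] at *
    simpa using h1.trans h2
  · refine ext_cyl _ _ fun n => ?_
    have h1 := hF n fun i => (f (i + 1)).symm x i
    have h2 := (hf n _ _ n).2 (hG n x)
    rw [mem_cylinder_iff_eq] at *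
    simpa using h1.trans h2
  · have h1 := hF n x
    have h2 := hF n y
    have h3 := hf n x y n
    rw [mem_cylinder_iff_eq] at *
    rw [← h3]
    change cylinder (fun i => f (i + 1) y i) n = cylinder (fun i => f (i + 1) x i) n ↔ _
    rw [h1, h2]

theorem exists_perm_of_biDense {X A D E : Set Cantor} {K : ℕ → Set Cantor} (hX : FinClosed X)
    (hA : FinClosed A) (hAX : A ⊆ X) (hAc : A.Countable) (hD : BiDense A D) (hE : BiDense A E)
    (hDA : D ⊆ A) (hEA : E ⊆ A) (hK : ∀ n, IsClosed (K n)) (hKm : Monotone K)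
    (hKA : ∀ n, Disjoint (K n) A) (hKX : X \ A ⊆ ⋃ n, K n) :
    ∃ F : Equiv.Perm Cantor, LevelPreserving F ∧ (∀ x, F x ∈ X ↔ x ∈ X) ∧ F '' D = E := by
  have hne : A.Nonempty := by
    obtain ⟨y, _, hy, _⟩ := (hD (fun _ => false) 0).1
    exact ⟨y, hy⟩
  obtain ⟨a, rfl⟩ := hAc.exists_eq_range hne
  set A := range a
  let S := {s : Equiv.Perm Cantor × Set Cantor // Preserves X A s.1 ∧ s.2.Finite ∧ s.2 ⊆ A ∧
    ∀ p ∈ s.2, p ∈ D ↔ s.1 p ∈ E}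
  have step : ∀ (n : ℕ) (s : S), ∃ t : S, s.1.2 ⊆ t.1.2 ∧ a n ∈ t.1.2 ∧
      t.1.1.symm (a n) ∈ t.1.2 ∧ (∀ x ∈ s.1.2, t.1.1 x = s.1.1 x) ∧
      (∀ x ∈ K n, t.1.1 x = s.1.1 x) ∧ (∀ x ∈ K n, t.1.1.symm x = s.1.1.symm x) ∧
      ∀ x, t.1.1 x ∈ cylinder (s.1.1 x) n := by
    rintro n ⟨⟨f, P⟩, h1, h2, h3, h4⟩
    obtain ⟨g, Q, g1, g2, g3, g4, g5⟩ :=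
      exists_extend hX hA hAX hD hE (hK n) (hKA n) n h1 h2 h3 h4 (mem_range_self n)
    exact ⟨⟨⟨g, Q⟩, g1, g2, g3, g4⟩, g5⟩
  choose next hsub hmem hmem' heqP heqK heqK' hcyl using step
  let s₀ : S := ⟨⟨Equiv.refl _, ∅⟩, ⟨fun _ _ _ => Iff.rfl, fun _ => Iff.rfl, fun _ => Iff.rfl⟩,
    finite_empty, empty_subset _, by simp⟩
  let s : ℕ → S := fun n => Nat.rec s₀ (fun n t => next n t) n
  have hs : ∀ n, s (n + 1) = next n (s n) := fun _ => rfl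
  let f : ℕ → Equiv.Perm Cantor := fun n => (s n).1.1
  let P : ℕ → Set Cantor := fun n => (s n).1.2
  have hPm : Monotone P := monotone_nat_of_le_succ fun n => hsub n (s n)
  obtain ⟨F, hF, hFf, hFf'⟩ := exists_limit (f := f) (fun n => (s n).2.1.level)
    fun n x => hcyl n (s n) x
  have ext_cyl : ∀ (x y : Cantor) (m : ℕ), (∀ n ≥ m, x ∈ cylinder y n) → x = y := fun x y m hxy =>
    funext fun i => hxy (max m (i + 1)) (le_max_left _ _) i (lt_of_lt_of_le i.lt_succ_self
      (le_max_right _ _))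
  have stable : ∀ (g : ℕ → Cantor → Cantor) (x : Cantor) (m : ℕ),
      (∀ n ≥ m, g (n + 1) x = g n x) → ∀ n ≥ m, g n x = g m x := by
    intro g x m hg n hn
    induction n, hn using Nat.le_induction with
    | base => rfl
    | succ n hn ih => rw [hg n hn, ih]
  have hFP : ∀ n, ∀ x ∈ P n, F x = f n x := fun m x hx => ext_cyl _ _ m fun n hn => by
    rw [← stable (fun n => f n) x m (fun n hn => heqP n (s n) x (hPm hn hx)) n hn]
    exact hFf n x
  have hFK : ∀ n, ∀ x ∈ K n, F x = f n x := fun m x hx => ext_cyl _ _ m fun n hn => by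
    rw [← stable (fun n => f n) x m (fun n hn => heqK n (s n) x (hKm hn hx)) n hn]
    exact hFf n x
  have hFK' : ∀ n, ∀ x ∈ K n, F.symm x = (f n).symm x := fun m x hx => ext_cyl _ _ m fun n hn => by
    rw [← stable (fun n => (f n).symm) x m (fun n hn => heqK' n (s n) x (hKm hn hx)) n hn]
    exact hFf' n x
  have hP : ∀ n, a n ∈ P (n + 1) := fun n => hmem n (s n)
  have hP' : ∀ n, F.symm (a n) ∈ P (n + 1) := fun n => by
    have h1 : (f (n + 1)).symm (a n) ∈ P (n + 1) := hmem' n (s n)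
    have h2 := hFP (n + 1) _ h1
    rw [Equiv.apply_symm_apply, ← Equiv.eq_symm_apply] at h2
    rwa [← h2]
  have hPA : ∀ n, P n ⊆ A := fun n => (s n).2.2.2.1
  have hPD : ∀ n, ∀ p ∈ P n, p ∈ D ↔ F p ∈ E := fun n p hp => by
    rw [hFP n p hp]
    exact (s n).2.2.2.2 p hp
  refine ⟨F, hF, fun x => ⟨fun hx => ?_, fun hx => ?_⟩, ?_⟩
  -- A point of `X` outside `A` lies in some `K n`, where `F` and its inverse agree with those of
  -- stage `n`, which preserves `X`.
  · by_cases hxA : F x ∈ A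
    · obtain ⟨n, hn⟩ := hxA
      have := hPA (n + 1) (hP' n)
      rw [hn, Equiv.symm_apply_apply] at this
      exact hAX this
    · obtain ⟨n, hn⟩ := mem_iUnion.1 (hKX ⟨hx, hxA⟩)
      have := hFK' n _ hn
      rw [Equiv.symm_apply_apply] at this
      rw [this]
      exact ((s n).2.1.symm.mem_left _).2 hx
  · by_cases hxA : x ∈ A
    · obtain ⟨n, rfl⟩ := hxA
      rw [hFP (n + 1) _ (hP n)]
      exact ((s (n + 1)).2.1.mem_left _).2 hx
    · obtain ⟨n, hn⟩ := mem_iUnion.1 (hKX ⟨hx, hxA⟩)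
      rw [hFK n _ hn]
      exact ((s n).2.1.mem_left _).2 hx
  · ext y
    constructor
    · rintro ⟨x, hx, rfl⟩
      obtain ⟨n, rfl⟩ := hDA hx
      exact (hPD (n + 1) _ (hP n)).1 hx
    · intro hy
      obtain ⟨n, rfl⟩ := hEA hy
      refine ⟨F.symm (a n), (hPD (n + 1) _ (hP' n)).2 (by simpa using hy), by simp⟩

/-! ### λ-sets closed under finite modifications are CDH -/

/-- A space all of whose countable subsets are `G_δ`. -/
def IsLambdaSpace (Z : Type*) [TopologicalSpace Z] : Prop :=
  ∀ A : Set Z, A.Countable → IsGδ A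

theorem IsLambdaSet.isLambdaSpace {X : Set Cantor} (h : IsLambdaSet X) : IsLambdaSpace X := by
  intro A hA
  have := h ((↑) '' A) (by rintro _ ⟨x, -, rfl⟩; exact x.2) (hA.image _)
  rwa [preimage_image_eq _ Subtype.val_injective] at this

theorem IsLambdaSpace.exists_closed_cover {X : Set Cantor} (h : IsLambdaSpace X) {A : Set Cantor}
    (hA : A.Countable) :
    ∃ K : ℕ → Set Cantor, (∀ n, IsClosed (K n)) ∧ Monotone K ∧ (∀ n, Disjoint (K n) (A ∩ X)) ∧
      X \ A ⊆ ⋃ n, K n := by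
  obtain ⟨V, hV, hAV⟩ := (h ((↑) ⁻¹' A) (hA.preimage Subtype.val_injective)).eq_iInter_nat
  choose U hU hUV using fun n => isOpen_induced_iff.1 (hV n)
  -- Finite unions make the closed sets increasing.
  refine ⟨fun n => ⋃ m ∈ Iio n, (U m)ᶜ,
    fun n => (finite_Iio n).isClosed_biUnion fun m _ => (hU m).isClosed_compl,
    fun m n hmn => biUnion_subset_biUnion_left (Iio_subset_Iio hmn), fun n => ?_, ?_⟩
  · rw [Set.disjoint_left]
    intro x hx hxA
    simp only [mem_iUnion] at hx
    obtain ⟨m, -, hm⟩ := hx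
    have : (⟨x, hxA.2⟩ : X) ∈ ⋂ n, V n := hAV ▸ hxA.1
    have := mem_iInter.1 this m
    rw [← hUV] at this
    exact hm this
  · rintro x ⟨hx, hxA⟩
    have : (⟨x, hx⟩ : X) ∉ ⋂ n, V n := hAV ▸ hxA
    simp only [mem_iInter, not_forall] at this
    obtain ⟨m, hm⟩ := this
    rw [← hUV] at hm
    simp only [mem_iUnion]
    exact ⟨m + 1, m, m.lt_succ_self, hm⟩

theorem isCDH_of_finClosed {X : Set Cantor} (hX : FinClosed X) (hl : IsLambdaSpace X)
    (hunc : ¬ X.Countable) : IsCDH X := by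
  refine ⟨inferInstance, fun D E hDc hD hEc hE => ?_⟩
  let B : Set Cantor := (↑) '' D ∪ (↑) '' E
  have hB : B.Countable := (hDc.image _).union (hEc.image _)
  have hBX : B ⊆ X := by
    rintro _ (⟨x, -, rfl⟩ | ⟨x, -, rfl⟩) <;> exact x.2
  let sat : Set Cantor → Set Cantor := fun C => ⋃ x ∈ C, {y | FinEq y x}
  have hsat : ∀ C : Set Cantor, C.Countable → (sat C).Countable := fun C hC =>
    hC.biUnion fun x _ => countable_finEq x
  -- The class of `p` is dense and misses `D` and `E`, which makes `A \ D` and `A \ E` dense.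
  obtain ⟨p, hpX, hp⟩ : ∃ p ∈ X, p ∉ sat B := by
    by_contra! hc
    exact hunc ((hsat B hB).mono hc)
  let A := sat (insert p B)
  have hAc : A.Countable := hsat _ (hB.insert p)
  have hA : FinClosed A := by
    intro x y hxy hx
    simp only [A, sat, mem_iUnion] at hx ⊢
    obtain ⟨z, hz, hxz⟩ := hx
    exact ⟨z, hz, hxy.symm.trans hxz⟩
  have hAX : A ⊆ X := by
    intro x hx
    simp only [A, sat, mem_iUnion] at hx
    obtain ⟨z, hz, hxz⟩ := hx
    exact hX (FinEq.symm hxz) (insert_subset hpX hBX hz)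
  have hBA : B ⊆ A := fun x hx => mem_biUnion (mem_insert_of_mem p hx) (FinEq.refl x)
  have bid : ∀ C : Set X, Dense C → (↑) '' C ⊆ B → BiDense A ((↑) '' C) := by
    intro C hC hCB c n
    constructor
    · obtain ⟨y, hy, hyp⟩ := exists_finEq_mem_cylinder p c n
      have ho : IsOpen ((↑) ⁻¹' cylinder c n : Set X) :=
        (isOpen_cylinder _ c n).preimage continuous_subtype_val
      obtain ⟨z, hz, hzC⟩ := hC.inter_open_nonempty _ ho ⟨⟨y, hX hyp.symm hpX⟩, hy⟩
      exact ⟨z, hz, hBA (hCB (mem_image_of_mem _ hzC)), mem_image_of_mem _ hzC⟩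
    · obtain ⟨y, hy, hyp⟩ := exists_finEq_mem_cylinder p c n
      exact ⟨y, hy, mem_biUnion (mem_insert p B) hyp,
        fun hyC => hp (mem_biUnion (hCB hyC) hyp.symm)⟩
  obtain ⟨K, hK, hKm, hKA, hKX⟩ := hl.exists_closed_cover hAc
  obtain ⟨F, hF, hFX, hFD⟩ := exists_perm_of_biDense hX hA hAX hAc
    (bid D hD subset_union_left) (bid E hE subset_union_right)
    (subset_union_left.trans hBA) (subset_union_right.trans hBA) hK hKm
    (fun n => (hKA n).mono_right (subset_inter Subset.rfl hAX)) hKX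
  let H : Cantor ≃ₜ Cantor := ⟨F, hF.continuous, hF.symm.continuous⟩
  refine ⟨H.subtype fun x => (hFX x).symm, ?_⟩
  refine Subtype.val_injective.image_injective ?_
  rw [← hFD, image_image, image_image]
  rfl

/-! ### Finite powers -/

theorem IsCDH.of_homeomorph {Y Z : Type*} [TopologicalSpace Y] [TopologicalSpace Z] (e : Y ≃ₜ Z)
    (h : IsCDH Z) : IsCDH Y := by
  have := h.1
  refine ⟨e.symm.surjective.denseRange.separableSpace e.symm.continuous,
    fun D E hDc hD hEc hE => ?_⟩
  obtain ⟨f, hf⟩ := h.2 (e '' D) (e '' E) (hDc.image e) (e.surjective.denseRange.dense_image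
    e.continuous hD) (hEc.image e) (e.surjective.denseRange.dense_image e.continuous hE)
  refine ⟨(e.trans f).trans e.symm, e.injective.image_injective ?_⟩
  rw [← hf, image_image, image_image]
  simp

theorem IsLambdaSpace.of_homeomorph {Y Z : Type*} [TopologicalSpace Y] [TopologicalSpace Z]
    (e : Y ≃ₜ Z) (h : IsLambdaSpace Z) : IsLambdaSpace Y := fun A hA => by
  have := (h (e '' A) (hA.image e)).preimage e.continuous
  rwa [preimage_image_eq _ e.injective] at this

/-- The box spanned by the projections of `A` is `G_δ` and, the index set being finite, countable.
Removing its countably many points outside `A` leaves a `G_δ` set. -/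
theorem IsLambdaSpace.pi {ι Z : Type*} [Finite ι] [TopologicalSpace Z] [T1Space Z]
    (h : IsLambdaSpace Z) : IsLambdaSpace (ι → Z) := by
  intro A hA
  have hB : (⋂ i, (fun x : ι → Z => x i) ⁻¹' ((fun x => x i) '' A)) =
      Set.univ.pi fun i => (fun x : ι → Z => x i) '' A := by
    ext x
    simp
  have hBc : (Set.univ.pi fun i => (fun x : ι → Z => x i) '' A).Countable :=
    countable_univ_pi fun i => hA.image _
  have hBG : IsGδ (Set.univ.pi fun i => (fun x : ι → Z => x i) '' A) := by
    rw [← hB]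
    exact .iInter fun i => (h _ (hA.image _)).preimage (continuous_apply i)
  have hAB : A ⊆ Set.univ.pi fun i => (fun x : ι → Z => x i) '' A := fun x hx i _ =>
    mem_image_of_mem _ hx
  have := hBG.inter ((hBc.mono sdiff_subset).isGδ_compl (s := _ \ A))
  rw [← sdiff_eq, sdiff_sdiff_right_self] at this
  rwa [← inter_eq_right.2 hAB]

/-- Interleaving identifies a finite power of the Cantor set with the Cantor set. -/
def interleave {n : ℕ} (e : Fin n × ℕ ≃ ℕ) : (Fin n → Cantor) ≃ₜ Cantor where
  toFun x k := x (e.symm k).1 (e.symm k).2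
  invFun z i j := z (e (i, j))
  left_inv x := by simp
  right_inv z := by simp
  continuous_toFun := by fun_prop
  continuous_invFun := by fun_prop

theorem isCDH_pi_fin {X : Set Cantor} (hX : FinClosed X) (hl : IsLambdaSet X)
    (hunc : ¬ X.Countable) (n : ℕ) : IsCDH (Fin n → X) := by
  rcases Nat.eq_zero_or_pos n with rfl | hn
  · refine ⟨inferInstance, fun D E _ hD _ hE => ⟨Homeomorph.refl _, ?_⟩⟩
    rw [Subsingleton.eq_univ_of_nonempty hD.nonempty, Subsingleton.eq_univ_of_nonempty hE.nonempty]
    simp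
  have : NeZero n := ⟨hn.ne'⟩
  obtain ⟨e⟩ : Nonempty (Fin n × ℕ ≃ ℕ) := nonempty_equiv_of_countable
  let Φ := interleave e
  let Y : Set Cantor := {z | ∀ i, Φ.symm z i ∈ X}
  have hY : FinClosed Y := fun z w hzw hz i => hX
    (hzw.preimage fun j _ k _ hjk => by simpa using hjk) (hz i)
  let Ψ : (Fin n → X) ≃ₜ Y :=
    { toFun x := ⟨Φ fun i => x i, fun i => by simp⟩
      invFun z i := ⟨Φ.symm z i, z.2 i⟩
      left_inv x := by simp
      right_inv z := by simp
      continuous_toFun := by fun_prop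
      continuous_invFun := by fun_prop }
  refine .of_homeomorph Ψ <|
    isCDH_of_finClosed hY (hl.isLambdaSpace.pi.of_homeomorph Ψ.symm) fun hc => hunc ?_
  have := hc.to_subtype
  have hinj : Function.Injective fun x : X => Ψ fun _ => x := fun x y hxy =>
    congrFun (Ψ.injective hxy) 0
  exact countable_coe_iff.1 hinj.countable

/-! ### The countably infinite power -/

/-- Write a countable dense set as an intersection of open sets and delete its `n`-th point from the
`n`-th of them. -/
theorem exists_open_dense_iInter_eq_empty {Z : Type*} [TopologicalSpace Z] [T1Space Z]
    [TopologicalSpace.SeparableSpace Z] [Nonempty Z] [∀ x : Z, (𝓝[≠] x).NeBot]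
    (h : IsLambdaSpace Z) :
    ∃ U : ℕ → Set Z, (∀ n, IsOpen (U n)) ∧ (∀ n, Dense (U n)) ∧ ⋂ n, U n = ∅ := by
  obtain ⟨D, hDc, hD⟩ := TopologicalSpace.exists_countable_dense Z
  obtain ⟨V, hV, hDV⟩ := (h D hDc).eq_iInter_nat
  obtain ⟨d, rfl⟩ := hDc.exists_eq_range hD.nonempty
  have hVd : ∀ n, Dense (V n) := fun n => hD.mono (hDV ▸ iInter_subset V n)
  refine ⟨fun n => V n \ {d n}, fun n => (hV n).sdiff isClosed_singleton,
    fun n => (hVd n).sdiff_singleton _, ?_⟩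
  rw [eq_empty_iff_forall_notMem]
  intro x hx
  rw [mem_iInter] at hx
  have hxD : x ∈ range d := hDV ▸ mem_iInter.2 fun n => (hx n).1
  obtain ⟨n, rfl⟩ := hxD
  exact (hx n).2 rfl

/-- Choose `d n` in the `n`-th basic set and in `U 0, …, U n`. Since every point misses some `U n`,
the range of `d` is the intersection of the sets `U n ∪ {d m | m < n}`. -/
theorem exists_countable_dense_isGδ {Z : Type*} [TopologicalSpace Z] [T1Space Z]
    [SecondCountableTopology Z] {U : ℕ → Set Z} (hU : ∀ n, IsOpen (U n))
    (hUd : ∀ n, Dense (U n)) (hUe : ⋂ n, U n = ∅) :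
    ∃ D : Set Z, D.Countable ∧ Dense D ∧ IsGδ D := by
  rcases isEmpty_or_nonempty Z with hZ | hZ
  · exact ⟨∅, countable_empty, fun x => hZ.elim x, .empty⟩
  obtain ⟨B, hBc, hB0, hB⟩ := TopologicalSpace.exists_countable_basis Z
  have hBne : B.Nonempty := by
    obtain ⟨x⟩ := hZ
    obtain ⟨b, hb, -⟩ := hB.exists_subset_of_mem_open (mem_univ x) isOpen_univ
    exact ⟨b, hb⟩
  obtain ⟨b, rfl⟩ := hBc.exists_eq_range hBne
  have hW : ∀ n, IsOpen (⋂ m ∈ Iic n, U m) ∧ Dense (⋂ m ∈ Iic n, U m) := fun n =>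
    ⟨(finite_Iic n).isOpen_biInter fun m _ => hU m, by
      induction n with
      | zero => simpa using hUd 0
      | succ n ih =>
        rw [show Iic (n + 1) = insert (n + 1) (Iic n) from Order.Iic_succ n, biInter_insert]
        exact (hUd _).inter_of_isOpen_left ih (hU _)⟩
  have hd : ∀ n, ∃ x ∈ b n, ∀ m ≤ n, x ∈ U m := fun n => by
    obtain ⟨x, hx, hxW⟩ := (hW n).2.inter_open_nonempty (b n) (hB.isOpen (mem_range_self n))
      (nonempty_iff_ne_empty.2 fun h0 => hB0 (h0 ▸ mem_range_self n))
    exact ⟨x, hx, fun m hm => mem_iInter₂.1 hxW m hm⟩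
  choose d hdb hdU using hd
  refine ⟨range d, countable_range d, ?_, ?_⟩
  · rw [hB.dense_iff]
    rintro _ ⟨n, rfl⟩ -
    exact ⟨d n, hdb n, mem_range_self n⟩
  · have : range d = ⋂ n, (U n ∪ d '' Iio n) := by
      ext x
      constructor
      · rintro ⟨m, rfl⟩
        refine mem_iInter.2 fun n => ?_
        rcases lt_or_ge m n with h | h
        · exact Or.inr (mem_image_of_mem d h)
        · exact Or.inl (hdU m n h)
      · intro hx
        rw [mem_iInter] at hx
        have : x ∉ ⋂ n, U n := by simp [hUe]
        rw [mem_iInter, not_forall] at this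
        obtain ⟨n, hn⟩ := this
        exact image_subset_range _ _ ((hx n).resolve_left hn)
    rw [this]
    exact .iInter fun n => (hU n).isGδ.union ((finite_Iio n).image d).isGδ

/-- Otherwise `G` and its complement would be disjoint dense `G_δ` sets. -/
theorem not_countable_of_isGδ_of_dense {Z : Type*} [TopologicalSpace Z] [T1Space Z] [BaireSpace Z]
    [Nonempty Z] [∀ x : Z, (𝓝[≠] x).NeBot] {G : Set Z} (hG : IsGδ G) (hGd : Dense G) :
    ¬ G.Countable := by
  intro hc
  have h1 : Dense (⋂ q ∈ G, ({q}ᶜ : Set Z)) :=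
    dense_biInter_of_isOpen (fun q _ => isOpen_compl_singleton) hc fun q _ =>
      dense_compl_singleton q
  have h2 : IsGδ (⋂ q ∈ G, ({q}ᶜ : Set Z)) :=
    .biInter_of_isOpen hc fun q _ => isOpen_compl_singleton
  obtain ⟨x, hx, hx'⟩ := (hGd.inter_of_Gδ hG h2 h1).nonempty
  exact mem_iInter₂.1 hx' x hx rfl

theorem exists_ne_finEq_mem_cylinder (x : Cantor) (n : ℕ) :
    ∃ y ∈ cylinder x n, y ≠ x ∧ FinEq x y := by
  refine ⟨Function.update x n (!x n), update_mem_cylinder _ _ _, fun h => ?_,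
    .of_eventually (n + 1) fun i hi => by simp [Function.update_of_ne (show i ≠ n by omega)]⟩
  simpa using congrFun h n

theorem Cantor.neBot_nhdsNE (x : Cantor) : (𝓝[≠] x).NeBot := by
  rw [← mem_closure_iff_nhdsWithin_neBot, mem_closure_iff]
  intro U hU hxU
  obtain ⟨n, hn⟩ := isOpen_iff_cylinder.1 hU x hxU
  obtain ⟨y, hy, hyx, -⟩ := exists_ne_finEq_mem_cylinder x n
  exact ⟨y, hn hy, hyx⟩

theorem FinClosed.neBot_nhdsNE {X : Set Cantor} (hX : FinClosed X) (x : X) :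
    (𝓝[≠] x).NeBot := by
  rw [← mem_closure_iff_nhdsWithin_neBot, mem_closure_iff]
  intro U hU hxU
  obtain ⟨V, hV, rfl⟩ := isOpen_induced_iff.1 hU
  obtain ⟨n, hn⟩ := isOpen_iff_cylinder.1 hV x hxU
  obtain ⟨y, hy, hyx, hxy⟩ := exists_ne_finEq_mem_cylinder x n
  exact ⟨⟨y, hX hxy x.2⟩, hn hy, fun h => hyx (congrArg Subtype.val h)⟩

theorem not_isCDH_pi_nat {X : Set Cantor} (hX : FinClosed X) (hl : IsLambdaSet X)
    (hne : X.Nonempty) : ¬ IsCDH (ℕ → X) := by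
  intro hcdh
  have : Nonempty X := hne.to_subtype
  have := hX.neBot_nhdsNE
  obtain ⟨U, hU, hUd, hUe⟩ := exists_open_dense_iInter_eq_empty hl.isLambdaSpace
  obtain ⟨D, hDc, hD, hDG⟩ := exists_countable_dense_isGδ
    (U := fun n => (fun x : ℕ → X => x 0) ⁻¹' U n) (fun n => (hU n).preimage (continuous_apply 0))
    (fun n => (hUd n).preimage (isOpenMap_eval 0)) (by rw [← preimage_iInter, hUe, preimage_empty])
  obtain ⟨p⟩ := ‹Nonempty X›
  obtain ⟨q, hqp⟩ : ∃ q : X, q ≠ p := (hX.neBot_nhdsNE p).nonempty_of_mem self_mem_nhdsWithin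
  -- The sequences with values in `{p, q}` form a copy of the Cantor set.
  let c : Cantor → ℕ → X := fun x n => if x n then p else q
  have hc : Continuous c := continuous_pi fun n =>
    (continuous_of_discreteTopology (f := fun t : Bool => if t then p else q)).comp
      (continuous_apply n)
  have hci : Function.Injective c := fun x y hxy => funext fun n => by
    have := congrFun hxy n
    cases hx : x n <;> cases hy : y n <;> simp_all [c]
  obtain ⟨Q, hQc, hQ⟩ := TopologicalSpace.exists_countable_dense Cantor
  have hA : (c '' Q ∪ D).Countable := (hQc.image c).union hDc
  obtain ⟨f, hf⟩ := hcdh.2 (c '' Q ∪ D) D hA (hD.mono subset_union_right) hDc hD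
  have hAG : IsGδ (c '' Q ∪ D) := by
    rw [← preimage_image_eq (c '' Q ∪ D) f.injective, hf]
    exact hDG.preimage f.continuous
  have := Cantor.neBot_nhdsNE
  -- Pulled back along `c`, the union would be a countable dense `G_δ` subset of the Cantor set.
  exact not_countable_of_isGδ_of_dense (hAG.preimage hc)
    (hQ.mono fun x hx => Or.inl (mem_image_of_mem c hx)) (hA.preimage hci)

end LambdaSets

theorem mainTheorem9 (X : Set LambdaSets.Cantor) (hunc : ¬ X.Countable)
    (hsat : LambdaSets.IsSaturated X) (hlam : LambdaSets.IsLambdaSet X) :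
    (∀ n : ℕ, LambdaSets.IsCDH (Fin n → X)) ∧ ¬ LambdaSets.IsCDH (ℕ → X) :=
  ⟨LambdaSets.isCDH_pi_fin hsat.finClosed hlam hunc,
    LambdaSets.not_isCDH_pi_nat hsat.finClosed hlam
      (Set.nonempty_iff_ne_empty.2 fun h => hunc (h ▸ Set.countable_empty))⟩
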